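/- For integers $n\ge 3$ and $2\le k<n/2$, let $C_n(1,k)$ be the circulant graph with vertices $v_0,\dots,v_{n-1}$ in which $v_i$ and $v_j$ are adjacent if and only if $i-j\equiv \pm 1$ or $i-j\equiv\pm k \pmod n$. The distinguishing chromatic number $\chi_D(G)$ of a graph $G$ is the minimum number of colors in a proper vertex coloring of $G$ such that the only automorphism of $G$ preserving the color of every vertex is the identity. Let $D_n$ denote the dihedral group of order $2n$. Let $n$ and $k$ be integers with $2<k<(n-1)/2$. If $n$ is odd, $k$ is even, and $\operatorname{Aut}(C_n(1,k))\cong D_n$, then $$\chi_D(C_n(1,k))=3.$$ -/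

import Mathlib

namespace SimpleGraph

/-- A (proper) coloring `c` of `G` is distinguishing if the trivial automorphism is the only
automorphism of `G` that preserves the color of every vertex. -/
def Coloring.IsDistinguishing {V α : Type*} {G : SimpleGraph V} (c : G.Coloring α) : Prop :=
  ∀ φ : G ≃g G, (∀ v, c (φ v) = c v) → φ = RelIso.refl _

/-- `G` has a proper distinguishing coloring with (at most) `r` colors. -/
def DistinguishingColorable {V : Type*} (G : SimpleGraph V) (r : ℕ) : Prop :=
  ∃ c : G.Coloring (Fin r), c.IsDistinguishing

/-- The distinguishing chromatic number of `G`: the least number of colors in a proper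
distinguishing coloring (`⊤` if no finite number suffices). -/
noncomputable def distinguishingChromaticNumber {V : Type*} (G : SimpleGraph V) : ℕ∞ :=
  ⨅ r ∈ {r : ℕ | G.DistinguishingColorable r}, (r : ℕ∞)

end SimpleGraph

/-- The circulant graph `C_n(1,k)`: distinct vertices `i`, `j` (residues modulo `n`) are adjacent
iff `i - j` is congruent to one of `±1`, `±k` modulo `n`. -/
def circulantOneK (n k : ℕ) : SimpleGraph (ZMod n) :=
  SimpleGraph.circulantGraph ({1, (k : ZMod n)} : Set (ZMod n))

/-! Three colors are needed because `n` is odd and the steps by `1` close up into an odd cycle. For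
three to suffice, choose a multiplier `t` placing both `t` and `t * k` strictly between a third and
two thirds of the modulus. Coloring `x` by the third of the circle containing `t * x` is then
proper, since every edge jumps farther than an arc. Dividing out the gcd makes `t` a unit modulo
some `N ∣ n`, so `x ↦ t * x` maps onto `ZMod N`. Recoloring the vertex `0` alone keeps the coloring
proper and breaks all translations and reflections, which by counting are the only automorphisms. -/

/-! ### Arithmetic of the multiplier. -/

/-- An integer multiplier carrying both `1` and `k` strictly into the middle third modulo `n`. -/
lemma exists_mul_mem_middle_third {n k : ℕ} (hk : 2 < k) (hkn : 2 * k + 3 ≤ n)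
    (hn : Odd n) (hke : Even k) :
    ∃ t u : ℕ, n < 3 * t ∧ 3 * t < 2 * n ∧ n < 3 * u ∧ 3 * u < 2 * n ∧
      (n : ℤ) ∣ (t : ℤ) * k - u := by
  obtain ⟨h, rfl⟩ := hke
  -- With `k = 2 * h` and `t = (n - m) / 2`, `t * k = (n - m) * h ≡ -w`, and the middle third is
  -- symmetric under negation.
  suffices H : ∃ m s w : ℕ, Odd m ∧ 3 * m < n ∧ n < 3 * w ∧ 3 * w < 2 * n ∧
      m * h = n * s + w by
    obtain ⟨m, s, w, hm, hmn, hw, hw', e⟩ := H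
    obtain ⟨a, rfl⟩ := hn
    obtain ⟨b, rfl⟩ := hm
    refine ⟨a - b, 2 * a + 1 - w, by omega, by omega, by omega, by omega, h - s - 1, ?_⟩
    zify at e
    rw [Nat.cast_sub (by omega), Nat.cast_sub (by omega)]
    push_cast
    linear_combination (-1 : ℤ) * e
  obtain ⟨r, rfl⟩ : ∃ r, n = 4 * h + r := ⟨n - 4 * h, by omega⟩
  by_cases hr : h < 2 * r
  · -- some odd `m` satisfies `n < 3 * m * h < 2 * n`
    have hh : 0 < h := by omega
    -- `2 * q + 3` is the least odd `m` with `3 * m * h > n`. The case hypothesis `h < 2 * r` is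
    -- exactly what `m = 3` needs to stay below `2 * n`.
    obtain ⟨q, hq, hq'⟩ : ∃ q, (2 * q + 1) * (3 * h) ≤ 4 * h + r ∧
        4 * h + r < (2 * q + 3) * (3 * h) := by
      have h6 : 0 < 6 * h := by omega
      have h1 := Nat.div_mul_le_self (h + r) (6 * h)
      have h2 := Nat.lt_div_mul_add (a := h + r) h6
      refine ⟨(h + r) / (6 * h), ?_, ?_⟩ <;> nlinarith
    have key : 3 * ((2 * q + 3) * h) < 2 * (4 * h + r) := by
      rcases Nat.eq_zero_or_pos q with rfl | hq0
      · omega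
      · by_cases hq1 : q = 1
        · subst hq1; omega
        · have : 2 * h ≤ q * h := Nat.mul_le_mul_right h (by omega)
          nlinarith
    refine ⟨2 * q + 3, 0, (2 * q + 3) * h, ⟨q + 1, by ring⟩, ?_, ?_, key, by ring⟩
    · have : (2 * q + 3) * 2 ≤ (2 * q + 3) * h := Nat.mul_le_mul_left _ (by omega)
      omega
    · nlinarith
  · have hr3 : 3 ≤ r := by omega
    -- Since `4 * h = n - r`, the residue of `(4 * i + 3) * h` is `3 * h - i * r`: it descends from
    -- `3 * h` in steps of `r`, and this `i` brings it below `2 * n / 3`.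
    obtain ⟨i, hi0, hi, hi'⟩ : ∃ i, 1 ≤ i ∧ h < (3 * i + 2) * r ∧ (3 * i) * r ≤ h + r := by
      have h3 : 0 < 3 * r := by omega
      have h1 := Nat.div_mul_le_self (h + r) (3 * r)
      have h2 := Nat.lt_div_mul_add (a := h + r) h3
      exact ⟨(h + r) / (3 * r), (Nat.le_div_iff_mul_le h3).2 (by omega), by nlinarith,
        by nlinarith⟩
    have h9 : 3 * i * 3 ≤ h + 3 := by
      have : (3 * i - 1) * 3 ≤ (3 * i - 1) * r := Nat.mul_le_mul_left _ hr3
      have h' : (3 * i - 1) * r + r = 3 * i * r := by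
        rw [← Nat.succ_mul]; congr 1; omega
      omega
    have hir : i * r ≤ 3 * h := by nlinarith
    refine ⟨4 * i + 3, i, 3 * h - i * r, ⟨2 * i + 1, by ring⟩, by omega, ?_, ?_, ?_⟩
    · rw [mul_assoc] at hi'
      omega
    · have : h < 3 * (i * r) + 2 * r := by linarith
      omega
    · zify [hir]
      ring

/-- Passing to a divisor of the modulus makes the multiplier coprime to the modulus. -/
lemma exists_coprime_mul_mem_middle_third {n k : ℕ} (hk : 2 < k) (hkn : 2 * k + 3 ≤ n)
    (hn : Odd n) (hke : Even k) :
    ∃ N t u : ℕ, N ∣ n ∧ Odd N ∧ t.Coprime N ∧ N < 3 * t ∧ 3 * t < 2 * N ∧ N < 3 * u ∧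
      3 * u < 2 * N ∧ ((t * k : ℕ) : ZMod N) = u := by
  obtain ⟨t, u, ht, ht', hu, hu', hd⟩ := exists_mul_mem_middle_third hk hkn hn hke
  obtain ⟨g, t, N, hg, hco, rfl, rfl⟩ := Nat.exists_coprime' (m := t) (n := n)
    (Nat.gcd_pos_of_pos_right _ (by omega))
  have hgu : (g : ℤ) ∣ u := by
    have h1 : (g : ℤ) ∣ ((t * g : ℕ) : ℤ) * k - u := (by simp : (g : ℤ) ∣ _).trans hd
    have h2 : (g : ℤ) ∣ ((t * g : ℕ) : ℤ) * k := by
      push_cast; exact ⟨t * k, by ring⟩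
    exact (dvd_sub_right h2).1 h1
  obtain ⟨u, rfl⟩ := Int.natCast_dvd_natCast.1 hgu
  refine ⟨N, t, u, ⟨g, rfl⟩, Nat.Odd.of_mul_left hn, hco, ?_, ?_, ?_, ?_, ?_⟩
  · by_contra! h; nlinarith
  · by_contra! h; nlinarith
  · by_contra! h; nlinarith
  · by_contra! h; nlinarith
  · have : (N : ℤ) ∣ ((t * k : ℕ) : ℤ) - (u : ℕ) := by
      obtain ⟨z, hz⟩ := hd
      refine ⟨z, ?_⟩
      have hg' : (g : ℤ) ≠ 0 := by exact_mod_cast hg.ne'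
      apply mul_left_cancel₀ hg'
      push_cast at hz ⊢
      linear_combination hz
    have := (ZMod.intCast_eq_intCast_iff_dvd_sub (u : ℤ) ((t * k : ℕ) : ℤ) N).2 this
    exact_mod_cast this.symm

/-! ### The three-arc coloring. -/

/-- The colour of `x` according to the arc of `ZMod N` containing `f x`; the single vertex `0` is
moved to the neighbouring arc. -/
def arcColor {n N : ℕ} (f : ZMod n →+ ZMod N) (x : ZMod n) : Fin 3 :=
  if x = 0 then 2
  else if (f x).val < (N + 2) / 3 then 0
  else if (f x).val < 2 * ((N + 2) / 3) then 1
  else 2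

lemma val_add_cases {N : ℕ} [NeZero N] (a b : ZMod N) :
    (a + b).val = a.val + b.val ∨ (a + b).val + N = a.val + b.val := by
  rcases lt_or_ge (a.val + b.val) N with h | h
  · exact Or.inl (ZMod.val_add_of_lt h)
  · exact Or.inr (ZMod.val_add_val_of_le h).symm

/-- Arc length is `N / 3` rounded up, so two values in one arc differ by less than `N / 3`. With `0`
adjoined as the endpoint `N`, the last arc still spans at most `N / 3`. -/
lemma arcColor_ne {n N : ℕ} [NeZero N] (f : ZMod n →+ ZMod N) {x d : ZMod n}
    (hd : N < 3 * (f d).val) (hd' : 3 * (f d).val < 2 * N) :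
    arcColor f (x + d) ≠ arcColor f x := by
  have hx := ZMod.val_lt (f x)
  have hy := ZMod.val_lt (f (x + d))
  have hc := val_add_cases (f x) (f d)
  rw [← map_add] at hc
  have h0 : x = 0 → (f x).val = 0 := by rintro rfl; simp
  have h0' : x + d = 0 → (f (x + d)).val = 0 := by intro h; simp [h]
  unfold arcColor
  split_ifs <;> first | decide | (intro; (try have := h0 ‹_›); (try have := h0' ‹_›); omega)

/-- Any other vertex of color 2 has a successor of color 2: the next value is still in the last arc,
or it wraps to `0`, where the vertex `0` is itself a witness. -/
lemma eq_zero_of_arcColor {n N : ℕ} [NeZero N] (f : ZMod n →+ ZMod N) (hN : 5 ≤ N) {x w : ZMod n}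
    (hw : f w = 1) (hx : arcColor f x = 2)
    (hs : ∀ y, f y = f x + 1 → arcColor f y = 0) : x = 0 := by
  by_contra hx0
  have : Fact (1 < N) := ⟨by omega⟩
  have h1 : (1 : ZMod N).val = 1 := ZMod.val_one N
  have hv : 2 * ((N + 2) / 3) ≤ (f x).val := by
    by_contra! h
    unfold arcColor at hx
    split_ifs at hx
    all_goals omega
  have hlt := ZMod.val_lt (f x)
  rcases val_add_cases (f x) 1 with h | h
  · have h2 := hs (x + w) (by rw [map_add, hw])
    unfold arcColor at h2
    rw [map_add, hw] at h2
    split_ifs at h2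
    all_goals omega
  · have h3 : f x + 1 = 0 := (ZMod.val_eq_zero _).1 (by omega)
    have h2 := hs 0 (by rw [h3, map_zero])
    simp [arcColor] at h2

lemma arcColor_eq_zero_of_map_eq_one {n N : ℕ} (f : ZMod n →+ ZMod N) (hN : 5 ≤ N) {y : ZMod n}
    (hy : f y = 1) : arcColor f y = 0 := by
  have : Fact (1 < N) := ⟨by omega⟩
  have h1 : (1 : ZMod N).val = 1 := ZMod.val_one N
  have hy0 : y ≠ 0 := by
    rintro rfl
    rw [map_zero] at hy
    exact zero_ne_one hy
  unfold arcColor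
  rw [if_neg hy0, hy, if_pos (by omega)]

lemma translation_eq_zero {n N : ℕ} [NeZero N] (f : ZMod n →+ ZMod N) (hN : 5 ≤ N)
    {w a : ZMod n} (hw : f w = 1) (h : ∀ x, arcColor f (x + a) = arcColor f x) : a = 0 := by
  refine eq_zero_of_arcColor f hN hw (by simpa [arcColor] using h 0) fun y hy => ?_
  rw [← sub_add_cancel y a, h]
  exact arcColor_eq_zero_of_map_eq_one f hN (by rw [map_sub, hy, add_sub_cancel_left])

/-- The reflection would give `a` the color 2 of `0`, and `a - w` the color 0 of `w`. But stepping
back by one from color 2 never lands on color 0, as arcs have length at least 2. -/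
lemma not_reflection_invariant {n N : ℕ} [NeZero N] (f : ZMod n →+ ZMod N) (hN : 5 ≤ N)
    {w a : ZMod n} (hw : f w = 1) (h : ∀ x, arcColor f (a - x) = arcColor f x) : False := by
  have : Fact (1 < N) := ⟨by omega⟩
  have h1 : (1 : ZMod N).val = 1 := ZMod.val_one N
  have ha : arcColor f a = 2 := by simpa [arcColor] using h 0
  have hp : arcColor f (a - w) = 0 := by
    rw [h]; exact arcColor_eq_zero_of_map_eq_one f hN hw
  have hlt := ZMod.val_lt (f a)
  have hlt' := ZMod.val_lt (f (a - w))
  have hc := val_add_cases (f (a - w)) 1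
  rw [map_sub, hw, sub_add_cancel, ← hw, ← map_sub] at hc
  rw [hw, h1] at hc
  have h0 : a = 0 → (f a).val = 0 := by rintro rfl; simp
  unfold arcColor at ha hp
  split_ifs at ha hp
  all_goals (try have := h0 ‹_›); omega

/-! ### Automorphisms of the circulant graph. -/

/-- Translation by `a`, or reflection `x ↦ a - x`, as an automorphism of a circulant graph. -/
def circulantDihedral {n : ℕ} (S : Set (ZMod n)) (p : ZMod n × Bool) :
    SimpleGraph.circulantGraph S ≃g SimpleGraph.circulantGraph S where
  toEquiv := if p.2 then Equiv.subLeft p.1 else Equiv.addRight p.1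
  map_rel_iff' := by
    rintro x y
    obtain ⟨a, _ | _⟩ := p
    · simp [SimpleGraph.circulantGraph]
    · simp [SimpleGraph.circulantGraph, or_comm]

lemma circulantDihedral_false_apply {n : ℕ} (S : Set (ZMod n)) (a x : ZMod n) :
    circulantDihedral S (a, false) x = x + a := rfl

lemma circulantDihedral_true_apply {n : ℕ} (S : Set (ZMod n)) (a x : ZMod n) :
    circulantDihedral S (a, true) x = a - x := rfl

lemma circulantDihedral_injective {n : ℕ} (hn : 2 < n) (S : Set (ZMod n)) :
    Function.Injective (circulantDihedral S) := by
  have h2 : (1 : ZMod n) ≠ -1 := by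
    intro h
    have h' : ((2 : ℕ) : ZMod n) = 0 := by
      push_cast
      linear_combination h
    exact absurd (Nat.le_of_dvd two_pos ((ZMod.natCast_eq_zero_iff 2 n).1 h')) (by omega)
  rintro ⟨a, _ | _⟩ ⟨b, _ | _⟩ h
  all_goals
    have e0 := DFunLike.congr_fun h 0
    have e1 := DFunLike.congr_fun h 1
    simp only [circulantDihedral_false_apply, circulantDihedral_true_apply] at e0 e1
    simp only [zero_add, sub_zero] at e0
    subst e0
  · rfl
  · exact absurd (by linear_combination e1) h2
  · exact absurd (by linear_combination -e1) h2
  · rfl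

/-- If the automorphism group is dihedral of order `2 * n`, it consists of the translations and
reflections of `ZMod n`. -/
lemma circulantDihedral_surjective {n : ℕ} (hn : 2 < n) (S : Set (ZMod n))
    (hAut : Nonempty ((SimpleGraph.circulantGraph S ≃g SimpleGraph.circulantGraph S) ≃*
      DihedralGroup n)) : Function.Surjective (circulantDihedral S) := by
  obtain ⟨e⟩ := hAut
  have : NeZero n := ⟨by omega⟩
  have : Finite (SimpleGraph.circulantGraph S ≃g SimpleGraph.circulantGraph S) :=
    Finite.of_equiv _ e.symm.toEquiv
  -- The isomorphism is abstract; only the order `2 * n` is used, making the injection a bijection.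
  refine ((circulantDihedral_injective hn S).bijective_of_nat_card_le ?_).2
  rw [Nat.card_congr e.toEquiv, DihedralGroup.nat_card, Nat.card_prod]
  simp [mul_comm]

lemma distinguishingColorable_circulantOneK {n k : ℕ} (hk : 2 < k) (hkn : 2 * k + 3 ≤ n)
    (hn : Odd n) (hke : Even k)
    (hAut : Nonempty ((circulantOneK n k ≃g circulantOneK n k) ≃* DihedralGroup n)) :
    (circulantOneK n k).DistinguishingColorable 3 := by
  obtain ⟨N, t, u, hNn, hNo, hco, ht, ht', hu, hu', htk⟩ :=
    exists_coprime_mul_mem_middle_third hk hkn hn hke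
  -- For `N = 1` or `N = 3` no integer lies strictly inside the middle third.
  have hN : 5 ≤ N := by
    obtain ⟨a, rfl⟩ := hNo
    omega
  have : NeZero N := ⟨by omega⟩
  let f : ZMod n →+ ZMod N :=
    (AddMonoidHom.mulLeft (t : ZMod N)).comp (ZMod.castHom hNn (ZMod N)).toAddMonoidHom
  have hf : ∀ x, f x = t * ZMod.castHom hNn (ZMod N) x := fun _ => rfl
  have hf1 : (f 1).val = t := by
    rw [hf, map_one, mul_one, ZMod.val_cast_of_lt (by omega)]
  have hfk : (f k).val = u := by
    rw [hf, map_natCast, ← Nat.cast_mul, htk, ZMod.val_cast_of_lt (by omega)]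
  obtain ⟨w, hw⟩ : ∃ w, f w = 1 := by
    obtain ⟨w, hw⟩ := ZMod.castHom_surjective hNn (t : ZMod N)⁻¹
    exact ⟨w, by rw [hf, hw, ZMod.coe_mul_inv_eq_one t hco]⟩
  have hne : ∀ x y : ZMod n, x - y ∈ ({1, (k : ZMod n)} : Set (ZMod n)) →
      arcColor f x ≠ arcColor f y := by
    intro x y hxy
    rw [← add_sub_cancel y x]
    rcases hxy with h | h
    · rw [h]; exact arcColor_ne f (by omega) (by omega)
    · rw [Set.mem_singleton_iff.1 h]; exact arcColor_ne f (by omega) (by omega)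
  refine ⟨SimpleGraph.Coloring.mk (arcColor f) fun {x y} hxy => ?_, fun φ hφ => ?_⟩
  · rcases hxy.2 with h | h
    · exact hne x y h
    · exact (hne y x h).symm
  · obtain ⟨⟨a, _ | _⟩, rfl⟩ := circulantDihedral_surjective (by omega) _ hAut φ
    · obtain rfl := translation_eq_zero f hN (a := a) hw hφ
      ext x
      exact add_zero x
    · exact (not_reflection_invariant f hN (a := a) hw hφ).elim

lemma not_colorable_two_circulantOneK {n k : ℕ} (hn1 : 1 < n) (hn : Odd n) :
    ¬ (circulantOneK n k).Colorable 2 := by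
  rintro ⟨c⟩
  have : Fact (1 < n) := ⟨hn1⟩
  have hadj : ∀ x, c (x + 1) ≠ c x := fun x => c.valid (by
    simp [circulantOneK, SimpleGraph.circulantGraph])
  have hstep : ∀ x, c (x + 1 + 1) = c x := fun x => by
    have h1 := hadj x
    have h2 := hadj (x + 1)
    omega
  have heven : ∀ i : ℕ, c ((2 * i : ℕ) : ZMod n) = c 0 := by
    intro i
    induction i with
    | zero => simp
    | succ i ih =>
      rw [← ih, ← hstep (2 * i : ℕ)]
      congr 1
      push_cast
      ring
  obtain ⟨a, rfl⟩ := hn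
  -- `n + 1` is even and congruent to `1`, so the neighbors `0` and `1` share a color.
  refine hadj 0 ?_
  rw [← heven (a + 1), show 2 * (a + 1) = (2 * a + 1) + 1 by ring, Nat.cast_succ,
    ZMod.natCast_self]

theorem theorem7p7 (n k : ℕ) (hk : 2 < k) (hkn : (k : ℝ) < ((n : ℝ) - 1) / 2)
    (hn_odd : Odd n) (hk_even : Even k)
    (hAut : Nonempty ((circulantOneK n k ≃g circulantOneK n k) ≃* DihedralGroup n)) :
    (circulantOneK n k).distinguishingChromaticNumber = 3 := by
  have hkn' : 2 * k + 3 ≤ n := by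
    have h : 2 * k + 1 < n := by
      have : (2 * k + 1 : ℝ) < n := by linarith
      exact_mod_cast this
    obtain ⟨a, rfl⟩ := hn_odd
    omega
  refine le_antisymm (iInf₂_le 3
    (distinguishingColorable_circulantOneK hk hkn' hn_odd hk_even hAut)) ?_
  refine le_iInf₂ fun r hr => ?_
  obtain ⟨c, -⟩ := hr
  by_contra! h
  have hr2 : r ≤ 2 := by
    have : r < 3 := by exact_mod_cast h
    omega
  exact not_colorable_two_circulantOneK (by omega) hn_odd
    (SimpleGraph.Colorable.mono hr2 ⟨c⟩)
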